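/- Let $\mathbb{C}$ be a (Barr-)exact category, that is, a finitely complete category in which coequalizers of kernel pairs exist, regular epimorphisms are stable under pullback, and every internal equivalence relation is a kernel pair. Suppose that: (a) $\mathbb{C}$ has finite coproducts; (b) binary coproducts of pullback squares are pullback squares in $\mathbb{C}$; (c) for each monomorphism $m:S\to A$ in $\mathbb{C}$, the commutative square $[1_A,m]\circ(m+1_S)=m\circ[1_S,1_S]$ from $S+S$ to $A$, with other corners $A+S$ and $S$, is a pullback; (d) for each regular epimorphism $p:E\to B$ in $\mathbb{C}$, the commutative square $[1_B,1_B]\circ(p+p)=p\circ[1_E,1_E]$ from $E+E$ to $B$, with other corners $B+B$ and $E$, is a feeble pullback, i.e. the induced morphism from $E+E$ into the pullback of $[1_B,1_B]$ and $p$ is a regular epimorphism. Then $\mathbb{C}$ is coprotomodular, i.e. $\mathbb{C}^{\mathrm{op}}$ is protomodular. Here a category $\mathbb{D}$ is protomodular if pullbacks of split epimorphisms along arbitrary morphisms exist in $\mathbb{D}$ and, for every morphism $p:E\to B$ in $\mathbb{D}$, the pullback functor $p^*:\mathbf{Pt}_{\mathbb{D}}(B)\to\mathbf{Pt}_{\mathbb{D}}(E)$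 reflects isomorphisms, where $\mathbf{Pt}_{\mathbb{D}}(B)$ is the category of triples $(A,\alpha:A\to B,\beta:B\to A)$ with $\alpha\beta=1_B$, whose morphisms $(A,\alpha,\beta)\to(A',\alpha',\beta')$ are the morphisms $f:A\to A'$ with $\alpha' f=\alpha$ and $f\beta=\beta'$, and $p^*$ sends $(A,\alpha,\beta)$ to $(E\times_B A,\pi_1,\langle 1_E,\beta p\rangle)$. -/

import Mathlib

open CategoryTheory CategoryTheory.Limits

universe v u

namespace ExactCoproto

/-- A (Barr-)exact category: a regular category in which every internal equivalence relation
is effective, that is, is the kernel pair of some morphism. -/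
class BarrExact (C : Type u) [Category.{v} C] : Prop extends Regular C where
  exists_isKernelPair {R A : C} (r₁ r₂ : R ⟶ A) :
    IsEquivalenceRelation r₁ r₂ → ∃ (B : C) (q : A ⟶ B), IsKernelPair q r₁ r₂

section Condition

variable {C : Type u} [Category.{v} C]

/-- A commutative square
```
  W --f--> X
  |        |
  g        h
  v        v
  Y --i--> Z
```
is a feeble pullback if the induced morphism from `W` into the pullback of `h` and `i` is a
regular epimorphism. -/
structure IsFeeblePullback [HasPullbacks C] {W X Y Z : C}
    (f : W ⟶ X) (g : W ⟶ Y) (h : X ⟶ Z) (i : Y ⟶ Z) : Prop where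
  w : f ≫ h = g ≫ i
  isRegularEpi_lift : IsRegularEpi (pullback.lift f g w)

variable (C) in
/-- The condition on a finitely complete category: finite coproducts exist, binary coproducts of
pullback squares are pullback squares, the square of `m + 1` over the monomorphism `m` is a
pullback, and the codiagonal square of every regular epimorphism is a feeble pullback. -/
class CoproductCondition [HasFiniteLimits C] : Prop extends HasFiniteCoproducts C where
  /-- Binary coproducts of pullback squares are pullback squares. -/
  isPullback_coprod_map {W X Y Z W' X' Y' Z' : C}
    {f : W ⟶ X} {g : W ⟶ Y} {h : X ⟶ Z} {i : Y ⟶ Z}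
    {f' : W' ⟶ X'} {g' : W' ⟶ Y'} {h' : X' ⟶ Z'} {i' : Y' ⟶ Z'} :
    IsPullback f g h i → IsPullback f' g' h' i' →
      IsPullback (coprod.map f f') (coprod.map g g') (coprod.map h h') (coprod.map i i')
  /-- For a monomorphism `m : S ⟶ A`, the square with sides `m + 1 : S + S ⟶ A + S`,
  `[1, 1] : S + S ⟶ S`, `[1, m] : A + S ⟶ A` and `m` is a pullback. -/
  isPullback_of_mono {S A : C} (m : S ⟶ A) [Mono m] :
    IsPullback (coprod.map m (𝟙 S)) (coprod.desc (𝟙 S) (𝟙 S)) (coprod.desc (𝟙 A) m) m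
  /-- For a regular epimorphism `p : E ⟶ B`, the square with sides `p + p : E + E ⟶ B + B`,
  `[1, 1] : E + E ⟶ E`, `[1, 1] : B + B ⟶ B` and `p` is a feeble pullback. -/
  isFeeblePullback_of_isRegularEpi {E B : C} (p : E ⟶ B) [IsRegularEpi p] :
    IsFeeblePullback (coprod.map p p) (coprod.desc (𝟙 E) (𝟙 E)) (coprod.desc (𝟙 B) (𝟙 B)) p

end Condition

section Points

variable {C : Type u} [Category.{v} C]

/-- An object of the category `Pt(B)` of points over `B`: an object `A` with a morphism
`α : A ⟶ B` and a section `β : B ⟶ A` of it. -/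
structure Pt (B : C) where
  A : C
  α : A ⟶ B
  β : B ⟶ A
  w : β ≫ α = 𝟙 B

/-- A morphism of points over `B`: a morphism that commutes with the projections to `B` and with
their sections. -/
@[ext]
structure Pt.Hom {B : C} (X Y : Pt B) where
  hom : X.A ⟶ Y.A
  hom_α : hom ≫ Y.α = X.α
  β_hom : X.β ≫ hom = Y.β

instance (B : C) : Category (Pt B) where
  Hom X Y := Pt.Hom X Y
  id X := ⟨𝟙 X.A, Category.id_comp _, Category.comp_id _⟩
  comp f g := ⟨f.hom ≫ g.hom, by rw [Category.assoc, g.hom_α, f.hom_α],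
    by rw [← Category.assoc, f.β_hom, g.β_hom]⟩
  id_comp f := Pt.Hom.ext (Category.id_comp _)
  comp_id f := Pt.Hom.ext (Category.comp_id _)
  assoc f g h := Pt.Hom.ext (Category.assoc _ _ _)

@[ext]
theorem Pt.hom_ext {B : C} {X Y : Pt B} {f g : X ⟶ Y} (h : f.hom = g.hom) : f = g :=
  Pt.Hom.ext h

@[simp]
theorem Pt.id_hom {B : C} (X : Pt B) : Pt.Hom.hom (𝟙 X) = 𝟙 X.A := rfl

@[simp]
theorem Pt.comp_hom {B : C} {X Y Z : Pt B} (f : X ⟶ Y) (g : Y ⟶ Z) :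
    (f ≫ g).hom = f.hom ≫ g.hom := rfl

variable (C) in
/-- Pullbacks of split epimorphisms along arbitrary morphisms exist. -/
class HasPullbacksOfSplitEpis : Prop where
  hasPullback {E A B : C} (p : E ⟶ B) (α : A ⟶ B) [IsSplitEpi α] : HasPullback p α

instance [HasPullbacksOfSplitEpis C] {E B : C} (p : E ⟶ B) (X : Pt B) : HasPullback p X.α :=
  haveI : IsSplitEpi X.α := ⟨⟨⟨X.β, X.w⟩⟩⟩
  HasPullbacksOfSplitEpis.hasPullback p X.α

section

variable [HasPullbacksOfSplitEpis C] {E B : C} (p : E ⟶ B)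

/-- The morphism `⟨1, p ≫ β⟩` into the pullback of `p` and `α`. -/
noncomputable def ptSection (X : Pt B) : E ⟶ pullback p X.α :=
  pullback.lift (𝟙 E) (p ≫ X.β) (by simp [X.w])

@[simp]
theorem ptSection_fst (X : Pt B) : ptSection p X ≫ pullback.fst p X.α = 𝟙 E :=
  pullback.lift_fst _ _ _

@[simp]
theorem ptSection_snd (X : Pt B) : ptSection p X ≫ pullback.snd p X.α = p ≫ X.β :=
  pullback.lift_snd _ _ _

/-- The morphism between pullbacks along `p` induced by a morphism of points over `B`. -/
noncomputable def ptMap {X Y : Pt B} (f : X ⟶ Y) : pullback p X.α ⟶ pullback p Y.α :=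
  pullback.lift (pullback.fst p X.α) (pullback.snd p X.α ≫ f.hom)
    (pullback.condition.trans (by rw [Category.assoc, f.hom_α]))

@[simp]
theorem ptMap_fst {X Y : Pt B} (f : X ⟶ Y) :
    ptMap p f ≫ pullback.fst p Y.α = pullback.fst p X.α :=
  pullback.lift_fst _ _ _

@[simp]
theorem ptMap_snd {X Y : Pt B} (f : X ⟶ Y) :
    ptMap p f ≫ pullback.snd p Y.α = pullback.snd p X.α ≫ f.hom :=
  pullback.lift_snd _ _ _

theorem ptSection_ptMap {X Y : Pt B} (f : X ⟶ Y) :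
    ptSection p X ≫ ptMap p f = ptSection p Y := by
  apply pullback.hom_ext
  · rw [Category.assoc, ptMap_fst, ptSection_fst, ptSection_fst]
  · rw [Category.assoc, ptMap_snd, ptSection_snd, ← Category.assoc, ptSection_snd,
      Category.assoc, f.β_hom]

theorem ptMap_id (X : Pt B) : ptMap p (𝟙 X) = 𝟙 (pullback p X.α) := by
  apply pullback.hom_ext <;> simp

theorem ptMap_comp {X Y Z : Pt B} (f : X ⟶ Y) (g : Y ⟶ Z) :
    ptMap p (f ≫ g) = ptMap p f ≫ ptMap p g := by
  apply pullback.hom_ext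
  · simp
  · rw [Category.assoc, ptMap_snd, ptMap_snd, ← Category.assoc, ptMap_snd, Category.assoc,
      Pt.comp_hom]

/-- The change-of-base functor `p^* : Pt(B) ⥤ Pt(E)` of a morphism `p : E ⟶ B`, which sends
`(A, α, β)` to the pullback of `p` and `α` with its first projection and the section
`⟨1, p ≫ β⟩`. -/
noncomputable def ptPullback : Pt B ⥤ Pt E where
  obj X := ⟨pullback p X.α, pullback.fst p X.α, ptSection p X, ptSection_fst p X⟩
  map f := ⟨ptMap p f, ptMap_fst p f, ptSection_ptMap p f⟩
  map_id X := Pt.Hom.ext (ptMap_id p X)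
  map_comp f g := Pt.Hom.ext (ptMap_comp p f g)

end

variable (C) in
/-- A category is protomodular if pullbacks of split epimorphisms along arbitrary morphisms exist
and every change-of-base functor `p^*` between categories of points reflects isomorphisms. -/
class Protomodular : Prop extends HasPullbacksOfSplitEpis C where
  reflectsIsomorphisms {E B : C} (p : E ⟶ B) : (ptPullback p).ReflectsIsomorphisms

variable (C) in
/-- A category is coprotomodular if its opposite category is protomodular. -/
abbrev Coprotomodular : Prop := Protomodular Cᵒᵖ

end Points

end ExactCoproto

/-! Read in the opposite category, the claim is that split monomorphisms β : B ⟶ A have pushouts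
along every p : B ⟶ E, and that pushing out points along p reflects isomorphisms.

If p is a regular epimorphism with kernel pair K, the pushout is the quotient of A by the image of A
+ K in A × A, that is, the diagonal joined with K transported along β. The conditions on coproducts
allow A + K to be treated as a union: pulling back along a regular epimorphism respects the summands
up to a cover (`exists_isRegularEpi_coprod_pullback`), and so does pulling back along a monomorphism
through which one summand factors (`isPullback_coprod_of_mono`). Hence the relation is transitive,
and exactness shows that the pushout identifies nothing more. With this description an element chase
proves reflection.

For other p, the morphism [p, 1] : B + E ⟶ E is a split epimorphism, and pushing β + 1 out along it
amounts to pushing β out along p. This yields all the pushouts, and reflection for monomorphisms;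
image factorisation does the rest. -/

namespace ExactCoproto

attribute [local simp] coprod.inl_desc coprod.inr_desc coprod.inl_desc_assoc coprod.inr_desc_assoc
  coprod.inl_map coprod.inr_map coprod.inl_map_assoc coprod.inr_map_assoc prod.lift_fst prod.lift_snd

/-! ### Relations on generalized elements and effective quotients -/

section Relations

variable {C : Type u} [Category.{v} C]

/-- The pair of generalized elements `x`, `y` of `A` lies in the relation given by `r₁`, `r₂`. -/
def Related {R A T : C} (r₁ r₂ : R ⟶ A) (x y : T ⟶ A) : Prop :=
  ∃ t : T ⟶ R, t ≫ r₁ = x ∧ t ≫ r₂ = y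

theorem Related.precomp {R A T T' : C} {r₁ r₂ : R ⟶ A} {x y : T ⟶ A}
    (h : Related r₁ r₂ x y) (e : T' ⟶ T) : Related r₁ r₂ (e ≫ x) (e ≫ y) := by
  obtain ⟨t, rfl, rfl⟩ := h
  exact ⟨e ≫ t, by simp, by simp⟩

theorem Related.of_coprod [HasBinaryCoproducts C] {R A T₁ T₂ : C} {r₁ r₂ : R ⟶ A}
    {x y : T₁ ⨿ T₂ ⟶ A} (h₁ : Related r₁ r₂ (coprod.inl ≫ x) (coprod.inl ≫ y))
    (h₂ : Related r₁ r₂ (coprod.inr ≫ x) (coprod.inr ≫ y)) : Related r₁ r₂ x y := by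
  obtain ⟨t₁, h₁, h₁'⟩ := h₁
  obtain ⟨t₂, h₂, h₂'⟩ := h₂
  exact ⟨coprod.desc t₁ t₂, by ext <;> simp [*], by ext <;> simp [*]⟩

/-- A jointly monic pair is a subobject of A × A, and strong epimorphisms lift against it, so
membership can be tested on a cover. -/
theorem Related.of_strongEpi [HasBinaryProducts C] {R A T W : C} {r₁ r₂ : R ⟶ A}
    [Mono (prod.lift r₁ r₂)] (e : W ⟶ T) [StrongEpi e] {x y : T ⟶ A}
    (h : Related r₁ r₂ (e ≫ x) (e ≫ y)) : Related r₁ r₂ x y := by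
  obtain ⟨t, h₁, h₂⟩ := h
  have sq : CommSq t e (prod.lift r₁ r₂) (prod.lift x y) := ⟨by ext <;> simp [h₁, h₂]⟩
  refine ⟨sq.lift, ?_, ?_⟩
  · have := sq.fac_right =≫ prod.fst
    rwa [Category.assoc, prod.lift_fst, prod.lift_fst] at this
  · have := sq.fac_right =≫ prod.snd
    rwa [Category.assoc, prod.lift_snd, prod.lift_snd] at this

theorem isRegularEpi_of_isPullback [Regular C] {W X Y Z : C} {f : W ⟶ X} {g : W ⟶ Y}
    {h : X ⟶ Z} {i : Y ⟶ Z} (sq : IsPullback f g h i) [hh : IsRegularEpi h] : IsRegularEpi g :=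
  Regular.regularEpiIsStableUnderBaseChange.of_isPullback sq hh

/-- If the relation that two generalized elements are related, locally, by a pair `u₁, u₂` is an
equivalence relation, then `u₁`, `u₂` have a coequalizer, and elements that it identifies are
locally related. -/
theorem exists_effective_quotient [BarrExact C] {U A : C} (u₁ u₂ : U ⟶ A)
    (hr : Related u₁ u₂ (𝟙 A) (𝟙 A)) (hs : Related u₁ u₂ u₂ u₁)
    (ht : ∀ {R : C} (r₁ r₂ : R ⟶ A) [Mono (prod.lift r₁ r₂)], Related r₁ r₂ u₁ u₂ →
      Related r₁ r₂ (pullback.fst u₂ u₁ ≫ u₁) (pullback.snd u₂ u₁ ≫ u₂)) :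
    ∃ (Q : C) (q : A ⟶ Q), IsRegularEpi q ∧ u₁ ≫ q = u₂ ≫ q ∧
      (∀ {Z : C} (g : A ⟶ Z), u₁ ≫ g = u₂ ≫ g → ∃ h : Q ⟶ Z, q ≫ h = g) ∧
      ∀ {T : C} (x y : T ⟶ A), x ≫ q = y ≫ q →
        ∃ (W : C) (e : W ⟶ T), IsRegularEpi e ∧ Related u₁ u₂ (e ≫ x) (e ≫ y) := by
  obtain ⟨R, f, r₁, r₂, _, _, e₁, e₂⟩ : ∃ (R : C) (f : U ⟶ R) (r₁ r₂ : R ⟶ A),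
      IsRegularEpi f ∧ Mono (prod.lift r₁ r₂) ∧ f ≫ r₁ = u₁ ∧ f ≫ r₂ = u₂ := by
    let F := Regular.strongEpiMonoFactorisation (prod.lift u₁ u₂)
    refine ⟨F.I, F.e, F.m ≫ prod.fst, F.m ≫ prod.snd, inferInstance, ?_, ?_, ?_⟩
    · have : prod.lift (F.m ≫ prod.fst) (F.m ≫ prod.snd) = F.m := by ext <;> simp
      rw [this]
      infer_instance
    · rw [← Category.assoc, F.fac, prod.lift_fst]
    · rw [← Category.assoc, F.fac, prod.lift_snd]
  have hu : Related r₁ r₂ u₁ u₂ := ⟨f, e₁, e₂⟩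
  have mono : ∀ {T : C} {x y : T ⟶ A}, Related u₁ u₂ x y → Related r₁ r₂ x y := by
    rintro T x y ⟨t, rfl, rfl⟩
    exact hu.precomp t
  have hs' : Related r₁ r₂ r₂ r₁ := by
    apply Related.of_strongEpi f
    rw [e₁, e₂]
    exact mono hs
  have ht' : Related r₁ r₂ (pullback.fst r₂ r₁ ≫ r₁) (pullback.snd r₂ r₁ ≫ r₂) := by
    -- Composable pairs in R are covered by composable pairs in U: `a` lifts the first entry to U,
    -- and the pullback of `a` and `b` lifts both.
    let a := pullback.snd f (pullback.fst r₂ r₁)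
    let b := pullback.fst (pullback.snd r₂ r₁) f
    apply Related.of_strongEpi a
    apply Related.of_strongEpi (pullback.fst a b)
    let x : pullback a b ⟶ U := pullback.fst a b ≫ pullback.fst f (pullback.fst r₂ r₁)
    let y : pullback a b ⟶ U := pullback.snd a b ≫ pullback.snd (pullback.snd r₂ r₁) f
    have hx : x ≫ f = pullback.fst a b ≫ a ≫ pullback.fst r₂ r₁ := by
      simp only [x, a, Category.assoc, pullback.condition]
    have hy : y ≫ f = pullback.fst a b ≫ a ≫ pullback.snd r₂ r₁ := by
      rw [pullback.condition_assoc]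
      simp only [y, b, Category.assoc, pullback.condition]
    have hxy : x ≫ u₂ = y ≫ u₁ := by
      rw [← e₁, ← e₂, reassoc_of% hx, reassoc_of% hy, pullback.condition]
    have key := (ht r₁ r₂ hu).precomp (pullback.lift x y hxy)
    rw [pullback.lift_fst_assoc, pullback.lift_snd_assoc, ← e₁, ← e₂, reassoc_of% hx,
      reassoc_of% hy] at key
    exact key
  obtain ⟨r, hr₁, hr₂⟩ := mono hr
  obtain ⟨s, hs₁, hs₂⟩ := hs'
  obtain ⟨t, ht₁, ht₂⟩ := ht'
  have eqv : IsEquivalenceRelation r₁ r₂ := ⟨⟨{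
    right_cancellation := fun Y f g h₁ h₂ => by
      rw [← cancel_mono (prod.lift r₁ r₂)]
      ext <;> simpa [prod.comp_lift]
    r := r
    reflexivity₁ := hr₁
    reflexivity₂ := hr₂
    s := s
    symmetry₁ := hs₁
    symmetry₂ := hs₂
    c := _
    isLimit := pullbackIsPullback r₂ r₁
    t := t
    transitivity₁ := ht₁
    transitivity₂ := ht₂ }⟩⟩
  obtain ⟨B, q₀, hq₀⟩ := BarrExact.exists_isKernelPair r₁ r₂ eqv
  have := Regular.hasCoequalizer_of_isKernelPair hq₀
  -- Since `q₀` factors through the coequalizer, the latter identifies no more than `q₀` does.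
  have hq : IsKernelPair (coequalizer.π r₁ r₂) r₁ r₂ := by
    refine IsKernelPair.cancel_right (f₂ := coequalizer.desc q₀ hq₀.w)
      (coequalizer.condition r₁ r₂) ?_
    simpa using hq₀
  refine ⟨_, coequalizer.π r₁ r₂, inferInstance, ?_, fun {Z} g hg => ?_, fun {T} x y h => ?_⟩
  · rw [← e₁, ← e₂, Category.assoc, Category.assoc, coequalizer.condition]
  · refine ⟨coequalizer.desc g ?_, coequalizer.π_desc _ _⟩
    rw [← cancel_epi f, ← Category.assoc, ← Category.assoc, e₁, e₂, hg]
  · refine ⟨pullback (hq.lift x y h) f, pullback.fst _ _, inferInstance,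
      pullback.snd _ _, ?_, ?_⟩
    · rw [← e₁, ← Category.assoc, ← pullback.condition, Category.assoc, hq.lift_fst]
    · rw [← e₂, ← Category.assoc, ← pullback.condition, Category.assoc, hq.lift_snd]

end Relations

/-! ### Pulling back binary coproducts -/

section Coproducts

variable {C : Type u} [Category.{v} C]

/-- Pulling back along a regular epimorphism preserves binary coproducts up to a regular
epimorphism. -/
theorem exists_isRegularEpi_coprod_pullback [Regular C] [CoproductCondition C]
    {E B X Y X' Y' Z' : C} {p : E ⟶ B} [IsRegularEpi p] {x : X ⟶ B} {y : Y ⟶ B}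
    {x' : X' ⟶ X} {pX : X' ⟶ E} {y' : Y' ⟶ Y} {pY : Y' ⟶ E} {z' : Z' ⟶ X ⨿ Y} {pZ : Z' ⟶ E}
    (hX : IsPullback x' pX x p) (hY : IsPullback y' pY y p)
    (hZ : IsPullback z' pZ (coprod.desc x y) p) :
    ∃ l : X' ⨿ Y' ⟶ Z', IsRegularEpi l ∧ l ≫ z' = coprod.map x' y' ∧
      l ≫ pZ = coprod.desc pX pY := by
  have hp := CoproductCondition.isFeeblePullback_of_isRegularEpi p
  have := hp.isRegularEpi_lift
  let k : B ⨿ B ⟶ B := coprod.desc (𝟙 B) (𝟙 B)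
  have hxy : coprod.map x y ≫ k = coprod.desc x y := by simp [k]
  -- As [x, y] is x + y followed by the codiagonal, the pullback is formed in two stages. This
  -- exhibits `l` as a base change of the comparison `e` of the feeble pullback.
  let j : Z' ⟶ pullback k p := pullback.lift (z' ≫ coprod.map x y) pZ (by
    rw [Category.assoc, hxy, hZ.w])
  have hj₁ : j ≫ pullback.fst k p = z' ≫ coprod.map x y := pullback.lift_fst _ _ _
  have hj₂ : j ≫ pullback.snd k p = pZ := pullback.lift_snd _ _ _
  have hj : IsPullback z' j (coprod.map x y) (pullback.fst k p) := by
    refine IsPullback.of_bot ?_ hj₁.symm (IsPullback.of_hasPullback k p)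
    rw [hj₂, hxy]
    exact hZ
  let l : X' ⨿ Y' ⟶ Z' := hZ.lift (coprod.map x' y') (coprod.desc pX pY) (by
    ext <;> simp [hX.w, hY.w])
  have hl₁ : l ≫ z' = coprod.map x' y' := hZ.lift_fst _ _ _
  have hl₂ : l ≫ pZ = coprod.desc pX pY := hZ.lift_snd _ _ _
  refine ⟨l, ?_, hl₁, hl₂⟩
  have hm := CoproductCondition.isPullback_coprod_map hX hY
  let e : E ⨿ E ⟶ pullback k p := pullback.lift _ _ hp.w
  have he₁ : e ≫ pullback.fst k p = coprod.map p p := pullback.lift_fst _ _ _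
  have he₂ : e ≫ pullback.snd k p = coprod.desc (𝟙 E) (𝟙 E) := pullback.lift_snd _ _ _
  have hl : IsPullback l (coprod.map pX pY) j e := by
    refine IsPullback.of_right ?_ ?_ hj
    · rw [hl₁, he₁]
      exact hm
    · apply pullback.hom_ext
      · rw [Category.assoc, Category.assoc, hj₁, he₁, reassoc_of% hl₁, hm.w]
      · rw [Category.assoc, Category.assoc, hj₂, he₂, hl₂, coprod.map_desc, Category.comp_id,
          Category.comp_id]
  exact isRegularEpi_of_isPullback hl.flip

/-- Pulling back along a monomorphism `m` preserves binary coproducts whose second summand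
factors through `m`. -/
theorem isPullback_coprod_of_mono [HasFiniteLimits C] [CoproductCondition C] {S A X Y Y' : C}
    (m : S ⟶ A) [Mono m] {y : Y ⟶ A} {y' : Y' ⟶ Y} {yS : Y' ⟶ S} (hY : IsPullback y' yS y m)
    (x : X ⟶ S) :
    IsPullback (coprod.map y' (𝟙 X)) (coprod.desc yS x) (coprod.desc y (x ≫ m)) m := by
  have h := (CoproductCondition.isPullback_coprod_map hY
    (IsPullback.of_id_fst (f := x))).paste_vert (CoproductCondition.isPullback_of_mono m)
  simpa using h

theorem isPullback_coprod_of_mono' [HasFiniteLimits C] [CoproductCondition C] {S A X Y Y' : C}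
    (m : S ⟶ A) [Mono m] {y : Y ⟶ A} {y' : Y' ⟶ Y} {yS : Y' ⟶ S} (hY : IsPullback y' yS y m)
    (x : X ⟶ S) :
    IsPullback (coprod.map (𝟙 X) y') (coprod.desc x yS) (coprod.desc (x ≫ m) y) m := by
  refine (isPullback_coprod_of_mono m hY x).of_iso (coprod.braiding _ _) (coprod.braiding _ _)
    (Iso.refl _) (Iso.refl _) ?_ ?_ ?_ ?_ <;> simp

end Coproducts

/-! ### Pushouts along regular epimorphisms as quotients -/

section Quotients

variable {C : Type u} [Category.{v} C] [BarrExact C] [CoproductCondition C]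

/-- For a kernel pair `k₁`, `k₂` on a subobject `β` of `A`, the union of its image in `A` with the
diagonal is transitive. -/
theorem related_trans_of_isKernelPair {A B E K R : C} {β : B ⟶ A} [Mono β] {p : B ⟶ E}
    {k₁ k₂ : K ⟶ B} (hk : IsKernelPair p k₁ k₂) {r₁ r₂ : R ⟶ A} [Mono (prod.lift r₁ r₂)]
    (h : Related r₁ r₂ (coprod.desc (𝟙 A) (k₁ ≫ β)) (coprod.desc (𝟙 A) (k₂ ≫ β))) :
    Related r₁ r₂
      (pullback.fst (coprod.desc (𝟙 A) (k₂ ≫ β)) (coprod.desc (𝟙 A) (k₁ ≫ β)) ≫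
        coprod.desc (𝟙 A) (k₁ ≫ β))
      (pullback.snd (coprod.desc (𝟙 A) (k₂ ≫ β)) (coprod.desc (𝟙 A) (k₁ ≫ β)) ≫
        coprod.desc (𝟙 A) (k₂ ≫ β)) := by
  let u₁ : A ⨿ K ⟶ A := coprod.desc (𝟙 A) (k₁ ≫ β)
  let u₂ : A ⨿ K ⟶ A := coprod.desc (𝟙 A) (k₂ ≫ β)
  have u₁_inl : coprod.inl ≫ u₁ = 𝟙 A := coprod.inl_desc _ _
  have u₂_inl : coprod.inl ≫ u₂ = 𝟙 A := coprod.inl_desc _ _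
  have u₁_inr : coprod.inr ≫ u₁ = k₁ ≫ β := coprod.inr_desc _ _
  have u₂_inr : coprod.inr ≫ u₂ = k₂ ≫ β := coprod.inr_desc _ _
  have : IsSplitEpi u₂ := ⟨⟨⟨coprod.inl, u₂_inl⟩⟩⟩
  let δ : B ⟶ K := hk.lift (𝟙 B) (𝟙 B) rfl
  have : IsSplitEpi k₁ := ⟨⟨⟨δ, hk.lift_fst _ _ _⟩⟩⟩
  change Related r₁ r₂ u₁ u₂ at h
  change Related r₁ r₂ (pullback.fst u₂ u₁ ≫ u₁) (pullback.snd u₂ u₁ ≫ u₂)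
  have hK : Related r₁ r₂ (k₁ ≫ β) (k₂ ≫ β) := by
    rw [← u₁_inr, ← u₂_inr]
    exact h.precomp _
  let V := pullback (k₁ ≫ β) u₂
  let vK : V ⟶ K := pullback.fst _ _
  let vU : V ⟶ A ⨿ K := pullback.snd _ _
  have hV : IsPullback vK vU (k₁ ≫ β) u₂ := IsPullback.of_hasPullback _ _
  -- Pairs whose second entry comes from K. Pull `u₂` back along the monomorphism β, giving B + K,
  -- then along the split epimorphism `k₁`. This is covered by K and K ×_B K; on the latter,
  -- transitivity of the kernel pair applies.
  have hVK : Related r₁ r₂ (vU ≫ u₁) (vK ≫ k₂ ≫ β) := by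
    have hβ : IsPullback (coprod.map β (𝟙 K)) (coprod.desc (𝟙 B) k₂) u₂ β :=
      isPullback_coprod_of_mono β (IsPullback.of_id_snd (f := β)) k₂
    let z : V ⟶ B ⨿ K := hβ.lift vU (vK ≫ k₁) (by rw [Category.assoc, hV.w])
    have hz₁ : z ≫ coprod.map β (𝟙 K) = vU := hβ.lift_fst _ _ _
    have hz₂ : z ≫ coprod.desc (𝟙 B) k₂ = vK ≫ k₁ := hβ.lift_snd _ _ _
    have hz : IsPullback z vK (coprod.desc (𝟙 B) k₂) k₁ := by
      refine IsPullback.of_right ?_ hz₂ hβ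
      rw [hz₁]
      exact hV.flip
    obtain ⟨l, _, hl₁, hl₂⟩ := exists_isRegularEpi_coprod_pullback
      (IsPullback.of_id_snd (f := k₁)) (IsPullback.of_hasPullback k₂ k₁) hz
    have e₁ : l ≫ vU ≫ u₁ = coprod.desc (k₁ ≫ β) (pullback.fst k₂ k₁ ≫ k₁ ≫ β) := by
      rw [← hz₁, Category.assoc, reassoc_of% hl₁]
      ext <;> simp [u₁]
    have e₂ : l ≫ vK ≫ k₂ ≫ β = coprod.desc (k₂ ≫ β) (pullback.snd k₂ k₁ ≫ k₂ ≫ β) := by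
      rw [reassoc_of% hl₂]
      ext <;> simp
    apply Related.of_strongEpi l
    rw [e₁, e₂]
    apply Related.of_coprod
    · simpa using hK
    · let t : pullback k₂ k₁ ⟶ K := hk.lift (pullback.fst k₂ k₁ ≫ k₁) (pullback.snd k₂ k₁ ≫ k₂) (by
        rw [Category.assoc, Category.assoc, hk.w, pullback.condition_assoc, hk.w])
      have ht₁ : t ≫ k₁ = pullback.fst k₂ k₁ ≫ k₁ := hk.lift_fst _ _ _
      have ht₂ : t ≫ k₂ = pullback.snd k₂ k₁ ≫ k₂ := hk.lift_snd _ _ _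
      have := hK.precomp t
      rw [reassoc_of% ht₁, reassoc_of% ht₂] at this
      simpa using this
  -- Split all composable pairs by whether the second entry is in A or in K, using that `u₂` is a
  -- split epimorphism.
  obtain ⟨l, _, hl₁, hl₂⟩ := exists_isRegularEpi_coprod_pullback
    (IsPullback.of_id_snd (f := u₂)) hV (IsPullback.of_hasPullback u₂ u₁).flip
  have e₁ : l ≫ pullback.fst u₂ u₁ ≫ u₁ = coprod.desc u₁ (vU ≫ u₁) := by
    rw [reassoc_of% hl₂]
    ext <;> simp
  have e₂ : l ≫ pullback.snd u₂ u₁ ≫ u₂ = coprod.desc u₂ (vK ≫ k₂ ≫ β) := by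
    rw [reassoc_of% hl₁]
    ext <;> simp [u₂]
  apply Related.of_strongEpi l
  rw [e₁, e₂]
  apply Related.of_coprod
  · simpa using h
  · simpa using hVK

/-- Pushouts of split monomorphisms along regular epimorphisms exist and identify two elements just
when, locally, these are equal or come from elements identified by the regular epimorphism. -/
theorem exists_isPushout_of_isRegularEpi {A B E K : C} {β : B ⟶ A} [IsSplitMono β] {p : B ⟶ E}
    [IsRegularEpi p] {k₁ k₂ : K ⟶ B} (hk : IsKernelPair p k₁ k₂) :
    ∃ (P : C) (inl : A ⟶ P) (inr : E ⟶ P), IsPushout β p inl inr ∧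
      ∀ {T : C} (x y : T ⟶ A), x ≫ inl = y ≫ inl →
        ∃ (W : C) (e : W ⟶ T), IsRegularEpi e ∧ Related (coprod.desc (𝟙 A) (k₁ ≫ β))
          (coprod.desc (𝟙 A) (k₂ ≫ β)) (e ≫ x) (e ≫ y) := by
  obtain ⟨Q, q, hq, hw, hu, hrel⟩ := exists_effective_quotient
    (coprod.desc (𝟙 A) (k₁ ≫ β)) (coprod.desc (𝟙 A) (k₂ ≫ β))
    ⟨coprod.inl, by simp, by simp⟩
    ⟨coprod.map (𝟙 A) (hk.lift k₂ k₁ hk.w.symm),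
      by ext <;> simp [reassoc_of% hk.lift_fst], by ext <;> simp [reassoc_of% hk.lift_snd]⟩
    (fun _ _ _ h => related_trans_of_isKernelPair hk h)
  have hw' : k₁ ≫ β ≫ q = k₂ ≫ β ≫ q := by simpa using coprod.inr ≫= hw
  let j : E ⟶ Q := Cofork.IsColimit.desc (hk.toCoequalizer (IsRegularEpi.getStruct p)) (β ≫ q) hw'
  have hj : p ≫ j = β ≫ q := Cofork.IsColimit.π_desc (hk.toCoequalizer (IsRegularEpi.getStruct p))
  have : Epi p := inferInstance
  refine ⟨Q, q, j, ⟨⟨hj.symm⟩, ⟨?_⟩⟩, hrel⟩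
  · have key : ∀ s : PushoutCocone β p, coprod.desc (𝟙 A) (k₁ ≫ β) ≫ s.inl =
        coprod.desc (𝟙 A) (k₂ ≫ β) ≫ s.inl := fun s => by
      ext
      · simp
      · simp [s.condition, reassoc_of% hk.w]
    choose d hd using fun s => hu _ (key s)
    refine PushoutCocone.IsColimit.mk hj.symm d hd (fun s => ?_) (fun s m h₁ h₂ => ?_)
    · rw [← cancel_epi p, reassoc_of% hj, hd, s.condition]
    · rw [← cancel_epi q, h₁, hd]

end Quotients

/-! ### Reflection of isomorphisms -/

section Reflection

variable {C : Type u} [Category.{v} C]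

/-- Pushing out points along `p` reflects isomorphisms. -/
def PushoutReflectsIso {B E : C} (p : B ⟶ E) : Prop :=
  ∀ {A A' P P' : C} {β : B ⟶ A} {α : A ⟶ B} {β' : B ⟶ A'} {α' : A' ⟶ B}
    {inl : A ⟶ P} {inr : E ⟶ P} {inl' : A' ⟶ P'} {inr' : E ⟶ P'} (f : A ⟶ A') (φ : P ⟶ P'),
    β ≫ α = 𝟙 B → β' ≫ α' = 𝟙 B → IsPushout β p inl inr → IsPushout β' p inl' inr' →
    β ≫ f = β' → f ≫ α' = α → inl ≫ φ = f ≫ inl' → inr ≫ φ = inr' → IsIso φ → IsIso f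

theorem strongEpi_inl_of_isPushout {A B E P : C} {β : B ⟶ A} {p : B ⟶ E} [StrongEpi p]
    {inl : A ⟶ P} {inr : E ⟶ P} (hP : IsPushout β p inl inr) : StrongEpi inl where
  epi := ⟨fun g h hgh => hP.hom_ext hgh (by
    rw [← cancel_epi p, ← reassoc_of% hP.w, hgh, reassoc_of% hP.w])⟩
  llp X Y z _ := ⟨fun {f g} sq => by
    have sq' : CommSq (β ≫ f) p z (inr ≫ g) := ⟨by
      rw [Category.assoc, sq.w, reassoc_of% hP.w]⟩
    exact ⟨⟨⟨hP.desc f sq'.lift sq'.fac_left.symm, hP.inl_desc _ _ _,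
      hP.hom_ext (by rw [hP.inl_desc_assoc, sq.w]) (by rw [hP.inr_desc_assoc, sq'.fac_right])⟩⟩⟩⟩

/-- The pushout of `β` along `p` is the pushout of `β + 1` along `[p, 1]`. -/
theorem isPushout_coprod_iff [HasBinaryCoproducts C] {A B E P : C} (β : B ⟶ A) (p : B ⟶ E)
    (inl : A ⟶ P) (inr : E ⟶ P) :
    IsPushout (coprod.map β (𝟙 E)) (coprod.desc p (𝟙 E)) (coprod.desc inl inr) inr ↔
      IsPushout β p inl inr := by
  have key := IsPushout.of_coprod_inl_with_id β E
  have hp : coprod.inl ≫ coprod.desc p (𝟙 E) = p := coprod.inl_desc _ _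
  have hi : coprod.inl ≫ coprod.desc inl inr = inl := coprod.inl_desc _ _
  refine ⟨fun h => ?_, fun h => ?_⟩
  · simpa only [hp, hi] using (key.flip.paste_vert h)
  · refine IsPushout.of_top (h₁₁ := β) ?_ ?_ key.flip
    · rwa [hp, hi]
    · ext <;> simp [h.w]

variable [BarrExact C] [CoproductCondition C]

/-- Elements that are identified by the pushout along a regular epimorphism are equal or come from
elements identified by the regular epimorphism, locally. -/
theorem related_of_isPushout {A B E K P : C} {β : B ⟶ A} [IsSplitMono β] {p : B ⟶ E}
    [IsRegularEpi p] {k₁ k₂ : K ⟶ B} (hk : IsKernelPair p k₁ k₂) {inl : A ⟶ P} {inr : E ⟶ P}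
    (hP : IsPushout β p inl inr) {T : C} (x y : T ⟶ A) (h : x ≫ inl = y ≫ inl) :
    ∃ (W : C) (e : W ⟶ T), IsRegularEpi e ∧ Related (coprod.desc (𝟙 A) (k₁ ≫ β))
      (coprod.desc (𝟙 A) (k₂ ≫ β)) (e ≫ x) (e ≫ y) := by
  obtain ⟨P₀, i, j, hP₀, hrel⟩ := exists_isPushout_of_isRegularEpi (β := β) hk
  apply hrel
  rw [← hP.inl_desc i j hP₀.w, reassoc_of% h]

theorem pushoutReflectsIso_of_isRegularEpi {B E : C} (p : B ⟶ E) [IsRegularEpi p] :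
    PushoutReflectsIso p := by
  intro A A' P P' β α β' α' inl inr inl' inr' f φ hβ hβ' hP hP' hβf hfα hφ hφ' _
  have : IsSplitMono β := ⟨⟨⟨α, hβ⟩⟩⟩
  have : IsSplitMono β' := ⟨⟨⟨α', hβ'⟩⟩⟩
  let K := pullback p p
  let k₁ : K ⟶ B := pullback.fst p p
  let k₂ : K ⟶ B := pullback.snd p p
  have hk : IsKernelPair p k₁ k₂ := IsKernelPair.of_hasPullback p
  have hf : Mono f := by
    refine ⟨fun {T} x y hxy => ?_⟩
    have hα : x ≫ α = y ≫ α := by rw [← hfα, reassoc_of% hxy]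
    obtain ⟨W, e, _, t, ht₁, ht₂⟩ := related_of_isPushout hk hP x y (by
      rw [← cancel_mono φ, Category.assoc, Category.assoc, hφ, reassoc_of% hxy])
    rw [← cancel_epi e, ← ht₁, ← ht₂]
    -- Because `x` and `y` agree after α, the K-part of the witness `t` should lie on the diagonal
    -- δ. Precisely, [δ, 1] sends the image of `t` in B + K into δ, so `t` factors through A + B,
    -- where both projections to A are [1, β].
    let δ : B ⟶ K := hk.lift (𝟙 B) (𝟙 B) rfl
    have hδ₁ : δ ≫ k₁ = 𝟙 B := hk.lift_fst _ _ _
    have hδ₂ : δ ≫ k₂ = 𝟙 B := hk.lift_snd _ _ _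
    have : Mono δ := mono_of_mono_fac hδ₁
    have hsq : IsPullback (coprod.map (𝟙 B) δ) (coprod.desc (𝟙 B) (𝟙 B))
        (coprod.desc (𝟙 B ≫ δ) (𝟙 K)) δ :=
      isPullback_coprod_of_mono' δ (IsPullback.of_id_snd (f := δ)) (𝟙 B)
    have hsq' : IsPullback (coprod.map (𝟙 A) δ) (coprod.map α (𝟙 B)) (coprod.map α (𝟙 K))
        (coprod.map (𝟙 B) δ) :=
      CoproductCondition.isPullback_coprod_map (IsPullback.of_id_fst (f := α))
        (IsPullback.of_id_snd (f := δ))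
    have e₁ : coprod.map α (𝟙 K) ≫ coprod.desc (𝟙 B) k₁ = coprod.desc (𝟙 A) (k₁ ≫ β) ≫ α := by
      ext <;> simp [hβ]
    have e₂ : coprod.map α (𝟙 K) ≫ coprod.desc (𝟙 B) k₂ = coprod.desc (𝟙 A) (k₂ ≫ β) ≫ α := by
      ext <;> simp [hβ]
    have d₁ : coprod.desc (𝟙 B ≫ δ) (𝟙 K) ≫ k₁ = coprod.desc (𝟙 B) k₁ := by
      ext <;> simp [hδ₁]
    have d₂ : coprod.desc (𝟙 B ≫ δ) (𝟙 K) ≫ k₂ = coprod.desc (𝟙 B) k₂ := by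
      ext <;> simp [hδ₂]
    let s := hsq.lift (t ≫ coprod.map α (𝟙 K)) (e ≫ x ≫ α) (by
      apply hk.hom_ext
      · rw [Category.assoc, Category.assoc, d₁, e₁, reassoc_of% ht₁, Category.assoc, hδ₁,
          Category.comp_id]
      · rw [Category.assoc, Category.assoc, d₂, e₂, reassoc_of% ht₂, Category.assoc, hδ₂,
          Category.comp_id, hα])
    let w := hsq'.lift t s (hsq.lift_fst _ _ _).symm
    have hw : w ≫ coprod.map (𝟙 A) δ = t := hsq'.lift_fst _ _ _
    rw [← hw, Category.assoc, Category.assoc]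
    congr 1
    ext
    · simp
    · simp [reassoc_of% hδ₁, reassoc_of% hδ₂]
  -- Surjectivity: `f ≫ inl'` is a regular epimorphism, so every element of A' is locally identified
  -- by `inl'` with some f(a).
  have : StrongEpi inl := strongEpi_inl_of_isPushout hP
  have : IsRegularEpi (f ≫ inl') := by
    rw [← hφ]
    have : StrongEpi (inl ≫ φ) := strongEpi_comp _ _
    infer_instance
  have hZ := IsPullback.of_hasPullback (f ≫ inl') inl'
  have := isRegularEpi_of_isPullback hZ
  obtain ⟨W, e, _, t, ht₁, ht₂⟩ := related_of_isPushout hk hP'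
    (pullback.fst (f ≫ inl') inl' ≫ f) (pullback.snd (f ≫ inl') inl') (by
      rw [Category.assoc, hZ.w])
  -- The first entry of the witness lies in the subobject `f`, so the witness lifts from A' + K to A
  -- + K; its second entry then lies in `f` too.
  have hsq : IsPullback (coprod.map f (𝟙 K)) (coprod.desc (𝟙 A) (k₁ ≫ β))
      (coprod.desc (𝟙 A') ((k₁ ≫ β) ≫ f)) f :=
    isPullback_coprod_of_mono f (IsPullback.of_id_snd (f := f)) (k₁ ≫ β)
  rw [Category.assoc, hβf] at hsq
  let w := hsq.lift t (e ≫ pullback.fst (f ≫ inl') inl') (by rw [ht₁, Category.assoc])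
  have hw : w ≫ coprod.map f (𝟙 K) = t := hsq.lift_fst _ _ _
  have : StrongEpi ((w ≫ coprod.desc (𝟙 A) (k₂ ≫ β)) ≫ f) := by
    have : (w ≫ coprod.desc (𝟙 A) (k₂ ≫ β)) ≫ f = e ≫ pullback.snd (f ≫ inl') inl' := by
      rw [← ht₂, ← hw, Category.assoc, Category.assoc]
      congr 1
      ext <;> simp [hβf]
    rw [this]
    exact strongEpi_comp _ _
  have : StrongEpi f := strongEpi_of_strongEpi (w ≫ coprod.desc (𝟙 A) (k₂ ≫ β)) f
  exact isIso_of_mono_of_strongEpi f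

theorem exists_isPushout {A B E : C} (β : B ⟶ A) [IsSplitMono β] (p : B ⟶ E) :
    ∃ (P : C) (inl : A ⟶ P) (inr : E ⟶ P), IsPushout β p inl inr := by
  have : IsSplitEpi (coprod.desc p (𝟙 E)) := ⟨⟨⟨coprod.inr, coprod.inr_desc _ _⟩⟩⟩
  have : IsSplitMono (coprod.map β (𝟙 E)) := ⟨⟨⟨coprod.map (retraction β) (𝟙 E), by simp⟩⟩⟩
  obtain ⟨P, i, j, h, -⟩ := exists_isPushout_of_isRegularEpi (β := coprod.map β (𝟙 E))
    (IsKernelPair.of_hasPullback (coprod.desc p (𝟙 E)))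
  have hj : j = coprod.inr ≫ i := by simpa using (coprod.inr ≫= h.w).symm
  refine ⟨P, coprod.inl ≫ i, j, (isPushout_coprod_iff _ _ _ _).1 ?_⟩
  convert h
  ext <;> simp [hj]

/-- The split epimorphism [p, 1] shows that f + 1 is invertible over E; base change along 1 + p
gives the same over B. The codiagonals [1, β] and [1, β'] then recover `f`. -/
theorem pushoutReflectsIso_of_mono {B E : C} (p : B ⟶ E) [Mono p] : PushoutReflectsIso p := by
  intro A A' P P' β α β' α' inl inr inl' inr' f φ hβ hβ' hP hP' hβf hfα hφ hφ' _
  have : IsSplitEpi (coprod.desc p (𝟙 E)) := ⟨⟨⟨coprod.inr, coprod.inr_desc _ _⟩⟩⟩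
  have hfE : IsIso (coprod.map f (𝟙 E)) := by
    refine pushoutReflectsIso_of_isRegularEpi (coprod.desc p (𝟙 E))
      (α := coprod.map α (𝟙 E)) (α' := coprod.map α' (𝟙 E)) _ φ ?_ ?_
      ((isPushout_coprod_iff _ _ _ _).2 hP) ((isPushout_coprod_iff _ _ _ _).2 hP') ?_ ?_ ?_ hφ' ‹_›
    all_goals ext <;> simp [*]
  have h : ∀ {X : C} (x : X ⟶ B), IsPullback (coprod.map (𝟙 X) p) (coprod.desc x (𝟙 B))
      (coprod.desc (x ≫ p) (𝟙 E)) p := fun x =>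
    isPullback_coprod_of_mono' p (IsPullback.of_id_snd (f := p)) x
  have hfB : IsIso (coprod.map f (𝟙 B)) := by
    have hsq : IsPullback (coprod.map (𝟙 A) p) (coprod.map f (𝟙 B)) (coprod.map f (𝟙 E))
        (coprod.map (𝟙 A') p) :=
      CoproductCondition.isPullback_coprod_map (IsPullback.of_id_fst (f := f))
        (IsPullback.of_id_snd (f := p))
    exact (MorphismProperty.isomorphisms C).of_isPullback hsq hfE
  have comm : coprod.map f (𝟙 B) ≫ coprod.desc (𝟙 A') β' = coprod.desc (𝟙 A) β ≫ f := by
    ext <;> simp [hβf]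
  have : IsSplitEpi (coprod.desc (𝟙 A') β') := ⟨⟨⟨coprod.inl, coprod.inl_desc _ _⟩⟩⟩
  have : StrongEpi (coprod.desc (𝟙 A) β ≫ f) := by
    rw [← comm]
    exact strongEpi_comp _ _
  have : StrongEpi f := strongEpi_of_strongEpi (coprod.desc (𝟙 A) β) f
  have : Mono f := by
    have : IsSplitMono (coprod.inl : A ⟶ A ⨿ B) := ⟨⟨⟨coprod.desc (𝟙 A) β, coprod.inl_desc _ _⟩⟩⟩
    have h : f ≫ (coprod.inl : A' ⟶ A' ⨿ B) = coprod.inl ≫ coprod.map f (𝟙 B) :=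
      (coprod.inl_map _ _).symm
    have : Mono (f ≫ (coprod.inl : A' ⟶ A' ⨿ B)) := by
      rw [h]
      infer_instance
    exact mono_of_mono f (coprod.inl : A' ⟶ A' ⨿ B)
  exact isIso_of_mono_of_strongEpi f

/-- The pushout along p is computed in two stages through its image; invertibility descends first to
the intermediate comparison `g`, then to `f`. -/
theorem pushoutReflectsIso {B E : C} (p : B ⟶ E) : PushoutReflectsIso p := by
  obtain ⟨S, e, m, _, _, rfl⟩ : ∃ (S : C) (e : B ⟶ S) (m : S ⟶ E),
      IsRegularEpi e ∧ Mono m ∧ e ≫ m = p :=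
    let F := Regular.strongEpiMonoFactorisation p
    ⟨F.I, F.e, F.m, inferInstance, inferInstance, F.fac⟩
  intro A A' P P' β α β' α' inl inr inl' inr' f φ hβ hβ' hP hP' hβf hfα hφ hφ' _
  have : IsSplitMono β := ⟨⟨⟨α, hβ⟩⟩⟩
  have : IsSplitMono β' := ⟨⟨⟨α', hβ'⟩⟩⟩
  obtain ⟨Q, i, j, hQ⟩ := exists_isPushout β e
  obtain ⟨Q', i', j', hQ'⟩ := exists_isPushout β' e
  let d : Q ⟶ P := hQ.desc inl (m ≫ inr) (by rw [hP.w, Category.assoc])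
  let d' : Q' ⟶ P' := hQ'.desc inl' (m ≫ inr') (by rw [hP'.w, Category.assoc])
  have hi : i ≫ d = inl := hQ.inl_desc _ _ _
  have hj : j ≫ d = m ≫ inr := hQ.inr_desc _ _ _
  have hi' : i' ≫ d' = inl' := hQ'.inl_desc _ _ _
  have hj' : j' ≫ d' = m ≫ inr' := hQ'.inr_desc _ _ _
  have hd : IsPushout j m d inr := IsPushout.of_top (by rwa [hi]) hj hQ
  have hd' : IsPushout j' m d' inr' := IsPushout.of_top (by rwa [hi']) hj' hQ'
  let g : Q ⟶ Q' := hQ.desc (f ≫ i') j' (by rw [reassoc_of% hβf, hQ'.w])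
  have hig : i ≫ g = f ≫ i' := hQ.inl_desc _ _ _
  have hjg : j ≫ g = j' := hQ.inr_desc _ _ _
  let a : Q ⟶ S := hQ.desc (α ≫ e) (𝟙 S) (by rw [reassoc_of% hβ, Category.comp_id])
  let a' : Q' ⟶ S := hQ'.desc (α' ≫ e) (𝟙 S) (by rw [reassoc_of% hβ', Category.comp_id])
  have hia : i ≫ a = α ≫ e := hQ.inl_desc _ _ _
  have hja : j ≫ a = 𝟙 S := hQ.inr_desc _ _ _
  have hia' : i' ≫ a' = α' ≫ e := hQ'.inl_desc _ _ _
  have hja' : j' ≫ a' = 𝟙 S := hQ'.inr_desc _ _ _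
  have hg : IsIso g := by
    refine pushoutReflectsIso_of_mono m (α := a) (α' := a') g φ hja hja' hd hd' hjg ?_ ?_ hφ' ‹_›
    · apply hQ.hom_ext
      · rw [reassoc_of% hig, hia', hia, reassoc_of% hfα]
      · rw [reassoc_of% hjg, hja', hja]
    · apply hQ.hom_ext
      · rw [reassoc_of% hi, reassoc_of% hig, hi', hφ]
      · rw [reassoc_of% hj, reassoc_of% hjg, hj', hφ']
  exact pushoutReflectsIso_of_isRegularEpi e f g hβ hβ' hQ hQ' hβf hfα hig hjg hg

theorem coprotomodular_of_coproductCondition : Coprotomodular C :=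
  have : HasPullbacksOfSplitEpis Cᵒᵖ := ⟨fun {E A B} p α _ => by
    have : IsSplitMono α.unop :=
      ⟨⟨⟨(section_ α).unop, congrArg Quiver.Hom.unop (IsSplitEpi.id α)⟩⟩⟩
    obtain ⟨P, inl, inr, h⟩ := exists_isPushout α.unop p.unop
    exact h.op.hasPullback⟩
  { reflectsIsomorphisms := fun {E B} p => ⟨fun {X Y} f hf => by
      have hf' : IsIso (ptMap p f) := by
        obtain ⟨g, h₁, h₂⟩ := hf
        exact ⟨g.hom, congrArg Pt.Hom.hom h₁, congrArg Pt.Hom.hom h₂⟩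
      have hiso : IsIso f.hom.unop :=
        -- Passing to the opposite swaps source and target of `f`, and turns each section into a
        -- retraction.
        pushoutReflectsIso p.unop (β := Y.α.unop) (α := Y.β.unop) (β' := X.α.unop)
          (α' := X.β.unop) f.hom.unop (ptMap p f).unop
          (congrArg Quiver.Hom.unop Y.w) (congrArg Quiver.Hom.unop X.w)
          (IsPullback.of_hasPullback p Y.α).unop (IsPullback.of_hasPullback p X.α).unop
          (congrArg Quiver.Hom.unop f.hom_α) (congrArg Quiver.Hom.unop f.β_hom)
          (congrArg Quiver.Hom.unop (ptMap_snd p f)) (congrArg Quiver.Hom.unop (ptMap_fst p f))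
          inferInstance
      have hiso' : IsIso f.hom := (isIso_unop_iff f.hom).1 hiso
      refine ⟨⟨inv f.hom, ?_, ?_⟩, ?_, ?_⟩
      · rw [IsIso.inv_comp_eq, f.hom_α]
      · rw [IsIso.comp_inv_eq, f.β_hom]
      · exact Pt.hom_ext (IsIso.hom_inv_id f.hom)
      · exact Pt.hom_ext (IsIso.inv_hom_id f.hom)⟩ }

end Reflection

end ExactCoproto

theorem mainTheorem3 (C : Type u) [Category.{v} C] [ExactCoproto.BarrExact C]
    [ExactCoproto.CoproductCondition C] : ExactCoproto.Coprotomodular C :=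
  ExactCoproto.coprotomodular_of_coproductCondition
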